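/- Let $\mathbb{G}=(C(\mathbb{G}),\Delta)$ be a compact quantum group: $C(\mathbb{G})$ is a unital $C^*$-algebra and $\Delta: C(\mathbb{G})\to C(\mathbb{G})\otimes C(\mathbb{G})$ (minimal tensor product) is a coassociative unital $*$-homomorphism such that $\{\Delta(a)(b\otimes 1)\}$ and $\{\Delta(a)(1\otimes b)\}$, $a,b\in C(\mathbb{G})$, span dense subspaces. A (finite-dimensional) representation of $\mathbb{G}$ on $H_u=\mathbb{C}^{m}$ is an invertible $u=(u_{ij})\in M_m(C(\mathbb{G}))\cong B(H_u)\otimes C(\mathbb{G})$ with $\Delta(u_{ij})=\sum_k u_{ik}\otimes u_{kj}$; it is unitary if $u$ is a unitary. Put $\mathrm{Hom}(u,v)=\{A\in B(H_u,H_v): v(A\otimes 1)=(A\otimes 1)u\}$; $u$ and $v$ are equivalent if $\mathrm{Hom}(u,v)$ contains an invertible operator, and $u$ is irreducible if $H_u\neq 0$ and $\mathrm{Hom}(u,u)=\mathbb{C}\cdot \mathrm{Id}$. For a unitary representation $u$, an operator $X\in B(H_u)$ is called $\mathbb{G}_u$-invariant if $u(X\otimes 1)u^*=X\otimes 1$.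 Let $u_1,\dots,u_n$ be mutually inequivalent irreducible unitary representations of $\mathbb{G}$, let $n_k=\dim H_{u_k}$, and set $u=\bigoplus_{k=1}^n u_k$ on $H_u=\bigoplus_{k=1}^n H_{u_k}$. Let $p_k\in B(H_u)$ be the orthogonal projection of $H_u$ onto $H_{u_k}$. Then $X\in B(H_u)$ is $\mathbb{G}_u$-invariant if and only if $X\in\mathrm{span}_{\mathbb{C}}\{p_1,\dots,p_n\}$. Moreover, the set $\mathcal{D}(\mathbb{G}_u)$ of $\mathbb{G}_u$-invariant states (positive operators on $H_u$ of trace one that are $\mathbb{G}_u$-invariant) is convex, and its set of extreme points is $$\mathrm{Ext}\,\mathcal{D}(\mathbb{G}_u)=\Big\{\tfrac{1}{n_k}\,p_k : 1\le k\le n\Big\}.$$ -/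

import Mathlib

universe w

noncomputable section

open scoped TensorProduct InnerProductSpace
open UniformSpace

/-! ### Hilbert space tensor products -/

/-- The Hilbert space tensor product: the completion of the algebraic tensor product with respect to
the inner product `⟪ξ ⊗ η, ξ' ⊗ η'⟫ = ⟪ξ, ξ'⟫ ⟪η, η'⟫`. -/
def HilbertTensor (H K : Type w) [NormedAddCommGroup H] [InnerProductSpace ℂ H]
    [NormedAddCommGroup K] [InnerProductSpace ℂ K] : Type w :=
  Completion (H ⊗[ℂ] K)

namespace HilbertTensor

section

variable {H K L : Type w} [NormedAddCommGroup H] [InnerProductSpace ℂ H]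
  [NormedAddCommGroup K] [InnerProductSpace ℂ K]
  [NormedAddCommGroup L] [InnerProductSpace ℂ L]

instance : NormedAddCommGroup (HilbertTensor H K) :=
  inferInstanceAs (NormedAddCommGroup (Completion (H ⊗[ℂ] K)))
instance : InnerProductSpace ℂ (HilbertTensor H K) :=
  inferInstanceAs (InnerProductSpace ℂ (Completion (H ⊗[ℂ] K)))
instance : CompleteSpace (HilbertTensor H K) :=
  inferInstanceAs (CompleteSpace (Completion (H ⊗[ℂ] K)))

variable (H K) in
/-- The canonical isometry from the algebraic to the Hilbert space tensor product. -/
def mk : H ⊗[ℂ] K →ₗᵢ[ℂ] HilbertTensor H K :=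
  (Completion.toComplₗᵢ : H ⊗[ℂ] K →ₗᵢ[ℂ] Completion (H ⊗[ℂ] K))

theorem denseRange_mk : DenseRange (mk H K) := Completion.denseRange_coe

@[elab_as_elim]
theorem ind {p : HilbertTensor H K → Prop} (z : HilbertTensor H K) (hp : IsClosed {z | p z})
    (ih : ∀ x, p (mk H K x)) : p z :=
  Completion.induction_on (α := H ⊗[ℂ] K) z hp ih

theorem clm_ext {S T : HilbertTensor H K →L[ℂ] HilbertTensor H K}
    (h : ∀ z : H ⊗[ℂ] K, S (mk H K z) = T (mk H K z)) : S = T := by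
  ext z
  exact ind z (isClosed_eq S.continuous T.continuous) h

/-- The bounded operator `S ⊗ T` on the Hilbert space tensor product. -/
def mapOp (S : H →L[ℂ] H) (T : K →L[ℂ] K) : HilbertTensor H K →L[ℂ] HilbertTensor H K :=
  ((TensorProduct.mapL S T).completion : Completion (H ⊗[ℂ] K) →L[ℂ] Completion (H ⊗[ℂ] K))

theorem mapOp_mk (S : H →L[ℂ] H) (T : K →L[ℂ] K) (z : H ⊗[ℂ] K) :
    mapOp S T (mk H K z) = mk H K (TensorProduct.mapL S T z) :=
  ContinuousLinearMap.completion_apply_coe _ _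

theorem mapOp_mul (S S' : H →L[ℂ] H) (T T' : K →L[ℂ] K) :
    mapOp (S * S') (T * T') = mapOp S T * mapOp S' T' :=
  clm_ext fun z => by
    simp only [mul_apply_eq_comp, mapOp_mk, TensorProduct.mapL_mul]

theorem mapOp_one : mapOp (1 : H →L[ℂ] H) (1 : K →L[ℂ] K) = 1 :=
  clm_ext fun z => by
    rw [mapOp_mk]
    simp

theorem inner_mapL [CompleteSpace H] [CompleteSpace K] (S : H →L[ℂ] H) (T : K →L[ℂ] K)
    (x y : H ⊗[ℂ] K) :
    inner ℂ (TensorProduct.mapL (star S) (star T) x) y = inner ℂ x (TensorProduct.mapL S T y) := by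
  induction x using TensorProduct.induction_on with
  | zero => simp
  | add a b ha hb => simp only [map_add, inner_add_left, ha, hb]
  | tmul a b =>
    induction y using TensorProduct.induction_on with
    | zero => simp
    | add c d hc hd => simp only [map_add, inner_add_right, hc, hd]
    | tmul c d =>
      simp [ContinuousLinearMap.star_eq_adjoint, ContinuousLinearMap.adjoint_inner_left]

theorem mapOp_star [CompleteSpace H] [CompleteSpace K] (S : H →L[ℂ] H) (T : K →L[ℂ] K) :
    mapOp (star S) (star T) = star (mapOp S T) := by
  rw [ContinuousLinearMap.star_eq_adjoint (mapOp S T), ContinuousLinearMap.eq_adjoint_iff]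
  intro x y
  refine ind x (isClosed_eq (by fun_prop) (by fun_prop)) fun x => ?_
  refine ind y (isClosed_eq (by fun_prop) (by fun_prop)) fun y => ?_
  rw [mapOp_mk, mapOp_mk, LinearIsometry.inner_map_map, LinearIsometry.inner_map_map, inner_mapL]

variable (H K) in
/-- The star homomorphism `S ↦ S ⊗ 1`. -/
def leftHom [CompleteSpace H] [CompleteSpace K] :
    (H →L[ℂ] H) →⋆ₐ[ℂ] (HilbertTensor H K →L[ℂ] HilbertTensor H K) where
  toFun S := mapOp S 1
  map_one' := mapOp_one
  map_mul' S S' := by rw [← mapOp_mul, one_mul]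
  map_zero' := clm_ext fun z => by rw [mapOp_mk]; simp
  map_add' S S' := clm_ext fun z => by
    simp [mapOp_mk, TensorProduct.mapL_add_left]
  commutes' c := clm_ext fun z => by
    rw [mapOp_mk, Algebra.algebraMap_eq_smul_one, TensorProduct.mapL_smul_left,
      Algebra.algebraMap_eq_smul_one]
    have : TensorProduct.mapL (1 : H →L[ℂ] H) (1 : K →L[ℂ] K) z = z := by simp
    simp [this]
  map_star' S := by rw [← mapOp_star, star_one]

variable (H K) in
/-- The star homomorphism `T ↦ 1 ⊗ T`. -/
def rightHom [CompleteSpace H] [CompleteSpace K] :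
    (K →L[ℂ] K) →⋆ₐ[ℂ] (HilbertTensor H K →L[ℂ] HilbertTensor H K) where
  toFun T := mapOp 1 T
  map_one' := mapOp_one
  map_mul' S S' := by rw [← mapOp_mul, one_mul]
  map_zero' := clm_ext fun z => by rw [mapOp_mk]; simp
  map_add' S S' := clm_ext fun z => by
    simp [mapOp_mk, TensorProduct.mapL_add_right]
  commutes' c := clm_ext fun z => by
    rw [mapOp_mk, Algebra.algebraMap_eq_smul_one, TensorProduct.mapL_smul_right,
      Algebra.algebraMap_eq_smul_one]
    have : TensorProduct.mapL (1 : H →L[ℂ] H) (1 : K →L[ℂ] K) z = z := by simp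
    simp [this]
  map_star' S := by rw [← mapOp_star, star_one]

end

section assoc

variable (H K L : Type w) [NormedAddCommGroup H] [InnerProductSpace ℂ H]
  [NormedAddCommGroup K] [InnerProductSpace ℂ K]
  [NormedAddCommGroup L] [InnerProductSpace ℂ L]

/-- The canonical map from `(H ⊗ K) ⊗ L` (algebraic) to its Hilbert space completion. -/
def incl₁ : (H ⊗[ℂ] K) ⊗[ℂ] L →ₗᵢ[ℂ] HilbertTensor (HilbertTensor H K) L :=
  (mk (HilbertTensor H K) L).comp ((mk H K).rTensor L)

/-- The canonical map from `H ⊗ (K ⊗ L)` (algebraic) to its Hilbert space completion. -/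
def incl₂ : H ⊗[ℂ] (K ⊗[ℂ] L) →ₗᵢ[ℂ] HilbertTensor H (HilbertTensor K L) :=
  (mk H (HilbertTensor K L)).comp ((mk K L).lTensor H)

theorem denseRange_incl₁ : DenseRange (incl₁ H K L) := by
  have h : DenseRange ((mk H K).rTensor L) := by
    intro z
    induction z using TensorProduct.induction_on with
    | zero => exact subset_closure ⟨0, map_zero _⟩
    | add a b ha hb =>
      have := (LinearMap.range ((mk H K).rTensor L).toLinearMap).topologicalClosure.add_mem
        (x := a) (y := b) ha hb
      exact this
    | tmul a b =>
      refine ind a ?_ ?_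
      · exact isClosed_closure.preimage (f := fun a : HilbertTensor H K => a ⊗ₜ[ℂ] b)
          (TensorProduct.continuous_tmul.comp (by fun_prop : Continuous fun a => (a, b)))
      · intro a
        exact subset_closure ⟨a ⊗ₜ b, rfl⟩
  exact denseRange_mk.comp h (mk _ _).continuous

theorem denseRange_incl₂ : DenseRange (incl₂ H K L) := by
  have h : DenseRange ((mk K L).lTensor H) := by
    intro z
    induction z using TensorProduct.induction_on with
    | zero => exact subset_closure ⟨0, map_zero _⟩
    | add a b ha hb =>
      have := (LinearMap.range ((mk K L).lTensor H).toLinearMap).topologicalClosure.add_mem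
        (x := a) (y := b) ha hb
      exact this
    | tmul a b =>
      refine ind b ?_ ?_
      · exact isClosed_closure.preimage (f := fun b : HilbertTensor K L => a ⊗ₜ[ℂ] b)
          (TensorProduct.continuous_tmul.comp (by fun_prop : Continuous fun b => (a, b)))
      · intro b
        exact subset_closure ⟨a ⊗ₜ b, rfl⟩
  exact denseRange_mk.comp h (mk _ _).continuous

/-- The associator unitary, `(ξ ⊗ η) ⊗ ζ ↦ ξ ⊗ (η ⊗ ζ)`. -/
def assoc : HilbertTensor (HilbertTensor H K) L ≃ₗᵢ[ℂ] HilbertTensor H (HilbertTensor K L) :=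
  (TensorProduct.assoc ℂ H K L).extendOfIsometry (incl₁ H K L).toLinearMap
    (incl₂ H K L).toLinearMap (denseRange_incl₁ H K L) (denseRange_incl₂ H K L)
    (fun x => by
      change ‖incl₂ H K L (TensorProduct.assoc ℂ H K L x)‖ = ‖incl₁ H K L x‖
      rw [LinearIsometry.norm_map, LinearIsometry.norm_map, TensorProduct.norm_assoc])

end assoc

end HilbertTensor

/-! ### The minimal tensor product of two unital C⋆-algebras -/

/-- A representation of a unital C⋆-algebra on a Hilbert space. -/
structure HilbertRep (A : Type w) [CStarAlgebra A] where
  space : Type w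
  [normedAddCommGroup : NormedAddCommGroup space]
  [innerProductSpace : InnerProductSpace ℂ space]
  [completeSpace : CompleteSpace space]
  hom : A →⋆ₐ[ℂ] (space →L[ℂ] space)

attribute [instance] HilbertRep.normedAddCommGroup HilbertRep.innerProductSpace
  HilbertRep.completeSpace

/-- The pullback of a representation along a star homomorphism. -/
def HilbertRep.comp {A B : Type w} [CStarAlgebra A] [CStarAlgebra B] (π : HilbertRep B)
    (f : A →⋆ₐ[ℂ] B) : HilbertRep A where
  space := π.space
  hom := π.hom.comp f

section MinTensor

variable {A B C D : Type w} [CStarAlgebra A] [CStarAlgebra B] [CStarAlgebra C] [CStarAlgebra D]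

/-- The representation `π ⊗ ρ` of the algebraic tensor product `A ⊗ B` on the Hilbert space
tensor product, `a ⊗ b ↦ π a ⊗ ρ b`. -/
def algTensorRep (π : HilbertRep A) (ρ : HilbertRep B) :
    A ⊗[ℂ] B →ₐ[ℂ] (HilbertTensor π.space ρ.space →L[ℂ] HilbertTensor π.space ρ.space) :=
  Algebra.TensorProduct.lift
    ((HilbertTensor.leftHom π.space ρ.space).comp π.hom).toAlgHom
    ((HilbertTensor.rightHom π.space ρ.space).comp ρ.hom).toAlgHom
    (fun a b => by
      change HilbertTensor.mapOp (π.hom a) 1 * HilbertTensor.mapOp 1 (ρ.hom b) =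
        HilbertTensor.mapOp 1 (ρ.hom b) * HilbertTensor.mapOp (π.hom a) 1
      simp only [← HilbertTensor.mapOp_mul, one_mul, mul_one])

theorem algTensorRep_tmul (π : HilbertRep A) (ρ : HilbertRep B) (a : A) (b : B) :
    algTensorRep π ρ (a ⊗ₜ b) = HilbertTensor.mapOp (π.hom a) (ρ.hom b) := by
  simp only [algTensorRep, Algebra.TensorProduct.lift_tmul]
  change HilbertTensor.mapOp (π.hom a) 1 * HilbertTensor.mapOp 1 (ρ.hom b) = _
  simp only [← HilbertTensor.mapOp_mul, one_mul, mul_one]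

theorem algTensorRep_star (π : HilbertRep A) (ρ : HilbertRep B) (x : A ⊗[ℂ] B) :
    algTensorRep π ρ (star x) = star (algTensorRep π ρ x) := by
  induction x using TensorProduct.induction_on with
  | zero => simp
  | add a b ha hb => simp only [star_add, map_add, ha, hb]
  | tmul a b =>
    rw [TensorProduct.star_tmul, algTensorRep_tmul, algTensorRep_tmul, map_star, map_star,
      HilbertTensor.mapOp_star]

/-- The minimal (spatial) C⋆-norm on the algebraic tensor product:
`‖x‖ = sup ‖(π ⊗ ρ) x‖` over all representations `π` of `A` and `ρ` of `B`. -/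
def minNorm (x : A ⊗[ℂ] B) : ℝ :=
  ⨆ p : HilbertRep A × HilbertRep B, ‖algTensorRep p.1 p.2 x‖

theorem exists_bound (x : A ⊗[ℂ] B) :
    ∃ c : ℝ, ∀ (π : HilbertRep A) (ρ : HilbertRep B), ‖algTensorRep π ρ x‖ ≤ c := by
  induction x using TensorProduct.induction_on with
  | zero => exact ⟨0, fun π ρ => by simp⟩
  | add a b ha hb =>
    obtain ⟨c, hc⟩ := ha
    obtain ⟨d, hd⟩ := hb
    refine ⟨c + d, fun π ρ => ?_⟩
    rw [map_add]
    exact (norm_add_le _ _).trans (add_le_add (hc π ρ) (hd π ρ))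
  | tmul a b =>
    refine ⟨‖a‖ * ‖b‖, fun π ρ => ?_⟩
    have h1 : algTensorRep π ρ (a ⊗ₜ b) =
        ((HilbertTensor.leftHom π.space ρ.space).comp π.hom) a *
          ((HilbertTensor.rightHom π.space ρ.space).comp ρ.hom) b := by
      simp only [algTensorRep, Algebra.TensorProduct.lift_tmul]
      rfl
    rw [h1]
    exact (norm_mul_le _ _).trans (mul_le_mul (NonUnitalStarAlgHom.norm_apply_le _ _)
      (NonUnitalStarAlgHom.norm_apply_le _ _) (norm_nonneg _) (norm_nonneg _))

theorem norm_algTensorRep_le (π : HilbertRep A) (ρ : HilbertRep B) (x : A ⊗[ℂ] B) :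
    ‖algTensorRep π ρ x‖ ≤ minNorm x := by
  obtain ⟨c, hc⟩ := exists_bound x
  exact le_ciSup (f := fun p : HilbertRep A × HilbertRep B => ‖algTensorRep p.1 p.2 x‖)
    ⟨c, by rintro _ ⟨p, rfl⟩; exact hc p.1 p.2⟩ (π, ρ)

theorem minNorm_nonneg (x : A ⊗[ℂ] B) : 0 ≤ minNorm x :=
  Real.iSup_nonneg fun _ => norm_nonneg _

theorem minNorm_le {x : A ⊗[ℂ] B} {c : ℝ} (hc : 0 ≤ c)
    (h : ∀ (π : HilbertRep A) (ρ : HilbertRep B), ‖algTensorRep π ρ x‖ ≤ c) : minNorm x ≤ c :=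
  Real.iSup_le (fun p => h p.1 p.2) hc

variable (A B) in
/-- The algebraic tensor product, equipped with the minimal norm. -/
def AlgTensor : Type w := A ⊗[ℂ] B

namespace AlgTensor

instance : Ring (AlgTensor A B) := inferInstanceAs (Ring (A ⊗[ℂ] B))
instance : Algebra ℂ (AlgTensor A B) := inferInstanceAs (Algebra ℂ (A ⊗[ℂ] B))
instance : StarRing (AlgTensor A B) := inferInstanceAs (StarRing (A ⊗[ℂ] B))
instance : StarModule ℂ (AlgTensor A B) := inferInstanceAs (StarModule ℂ (A ⊗[ℂ] B))

/-- The representation `π ⊗ ρ`, on the type synonym. -/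
def rep (π : HilbertRep A) (ρ : HilbertRep B) : AlgTensor A B →ₐ[ℂ]
    (HilbertTensor π.space ρ.space →L[ℂ] HilbertTensor π.space ρ.space) :=
  algTensorRep π ρ

theorem rep_star (π : HilbertRep A) (ρ : HilbertRep B) (x : AlgTensor A B) :
    rep π ρ (star x) = star (rep π ρ x) :=
  algTensorRep_star π ρ x

/-- The minimal norm, on the type synonym. -/
def nrm (x : AlgTensor A B) : ℝ := minNorm (A := A) (B := B) x

theorem norm_rep_le (π : HilbertRep A) (ρ : HilbertRep B) (x : AlgTensor A B) :
    ‖rep π ρ x‖ ≤ nrm x :=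
  norm_algTensorRep_le π ρ x

theorem nrm_nonneg (x : AlgTensor A B) : 0 ≤ nrm x := minNorm_nonneg _

theorem nrm_le {x : AlgTensor A B} {c : ℝ} (hc : 0 ≤ c)
    (h : ∀ (π : HilbertRep A) (ρ : HilbertRep B), ‖rep π ρ x‖ ≤ c) : nrm x ≤ c :=
  minNorm_le hc h

variable (A B) in
/-- The minimal norm as a seminorm. -/
def groupSeminorm : AddGroupSeminorm (AlgTensor A B) where
  toFun x := nrm x
  map_zero' := le_antisymm (nrm_le le_rfl fun π ρ => by
    rw [map_zero, norm_zero]) (nrm_nonneg _)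
  add_le' x y := nrm_le (add_nonneg (nrm_nonneg _) (nrm_nonneg _)) fun π ρ => by
    rw [map_add]
    exact (norm_add_le _ _).trans (add_le_add (norm_rep_le π ρ _)
      (norm_rep_le π ρ _))
  neg' x := by
    have h : ∀ π ρ, ‖rep π ρ (-x)‖ = ‖rep π ρ x‖ :=
      fun π ρ => by rw [map_neg, norm_neg]
    exact congrArg iSup (funext fun p => h p.1 p.2)

instance : SeminormedRing (AlgTensor A B) where
  __ := (groupSeminorm A B).toSeminormedAddCommGroup
  __ := (inferInstance : Ring (AlgTensor A B))
  norm_mul_le x y := nrm_le (mul_nonneg (nrm_nonneg _) (nrm_nonneg _)) fun π ρ => by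
    rw [map_mul]
    exact (norm_mul_le _ _).trans (mul_le_mul (norm_rep_le π ρ _)
      (norm_rep_le π ρ _) (norm_nonneg _) (nrm_nonneg _))

instance : NormedAlgebra ℂ (AlgTensor A B) where
  norm_smul_le c x := nrm_le (mul_nonneg (norm_nonneg c) (nrm_nonneg _)) fun π ρ => by
    rw [map_smul, norm_smul]
    exact mul_le_mul_of_nonneg_left (norm_rep_le π ρ _) (norm_nonneg c)

theorem norm_star (x : AlgTensor A B) : ‖star x‖ = ‖x‖ :=
  have h : ∀ y : AlgTensor A B, ‖star y‖ ≤ ‖y‖ := fun y => nrm_le (nrm_nonneg _) fun π ρ => by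
    rw [rep_star, _root_.norm_star]
    exact norm_rep_le π ρ y
  le_antisymm (h x) ((congrArg norm (star_star x)).symm.le.trans (h (star x)))

instance : NormedStarGroup (AlgTensor A B) where
  norm_star_le x := (norm_star x).le

theorem norm_mul_self_le (x : AlgTensor A B) : ‖x‖ * ‖x‖ ≤ ‖star x * x‖ := by
  have h : ‖x‖ ≤ Real.sqrt ‖star x * x‖ := nrm_le (Real.sqrt_nonneg _) fun π ρ => by
    apply Real.le_sqrt_of_sq_le
    have := norm_rep_le π ρ (star x * x)
    rw [map_mul, rep_star, CStarRing.norm_star_mul_self, ← sq] at this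
    exact this
  calc ‖x‖ * ‖x‖ ≤ Real.sqrt ‖star x * x‖ * Real.sqrt ‖star x * x‖ :=
        mul_le_mul h h (norm_nonneg _) (Real.sqrt_nonneg _)
    _ = ‖star x * x‖ := Real.mul_self_sqrt (norm_nonneg _)

/-- The map `a ⊗ b ↦ f a ⊗ g b` between algebraic tensor products. -/
def map (f : A →⋆ₐ[ℂ] C) (g : B →⋆ₐ[ℂ] D) : AlgTensor A B →ₐ[ℂ] AlgTensor C D :=
  (Algebra.TensorProduct.map f.toAlgHom g.toAlgHom : A ⊗[ℂ] B →ₐ[ℂ] C ⊗[ℂ] D)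

theorem map_star_eq (f : A →⋆ₐ[ℂ] C) (g : B →⋆ₐ[ℂ] D) (x : AlgTensor A B) :
    map f g (star x) = star (map f g x) := by
  have h (x : A ⊗[ℂ] B) : Algebra.TensorProduct.map f.toAlgHom g.toAlgHom (star x) =
      star (Algebra.TensorProduct.map f.toAlgHom g.toAlgHom x) := by
    induction x using TensorProduct.induction_on with
    | zero => simp
    | add a b ha hb => simp only [star_add, map_add, ha, hb]
    | tmul a b => simp [TensorProduct.star_tmul, map_star]
  exact h x

theorem norm_map_le (f : A →⋆ₐ[ℂ] C) (g : B →⋆ₐ[ℂ] D) (x : AlgTensor A B) :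
    ‖map f g x‖ ≤ ‖x‖ := by
  refine nrm_le (nrm_nonneg _) fun π ρ => ?_
  have h (x : A ⊗[ℂ] B) :
      algTensorRep π ρ (Algebra.TensorProduct.map f.toAlgHom g.toAlgHom x) =
        algTensorRep (π.comp f) (ρ.comp g) x := by
    induction x using TensorProduct.induction_on with
    | zero => simp only [map_zero]; rfl
    | add a b ha hb => simp only [map_add, ha, hb]; rfl
    | tmul a b =>
      rw [Algebra.TensorProduct.map_tmul, algTensorRep_tmul, algTensorRep_tmul]
      rfl
  exact (congrArg norm (h x)).le.trans (norm_rep_le (π.comp f) (ρ.comp g) x)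

end AlgTensor

variable (A B) in
/-- The minimal (spatial) tensor product of two unital C⋆-algebras: the completion of the algebraic
tensor product in the minimal norm. -/
def MinTensor : Type w := Completion (AlgTensor A B)

namespace MinTensor

instance : NormedRing (MinTensor A B) := inferInstanceAs (NormedRing (Completion (AlgTensor A B)))
instance : CompleteSpace (MinTensor A B) :=
  inferInstanceAs (CompleteSpace (Completion (AlgTensor A B)))
instance : Algebra ℂ (MinTensor A B) :=
  inferInstanceAs (Algebra ℂ (Completion (AlgTensor A B)))

instance : NormedAlgebra ℂ (MinTensor A B) where
  norm_smul_le := norm_smul_le (α := ℂ) (β := Completion (AlgTensor A B))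

variable (A B) in
/-- The canonical map from the algebraic to the minimal tensor product. -/
def mk (x : AlgTensor A B) : MinTensor A B := (x : Completion (AlgTensor A B))

theorem norm_mk (x : AlgTensor A B) : ‖mk A B x‖ = ‖x‖ := Completion.norm_coe x

theorem continuous_mk : Continuous (mk A B) := Completion.continuous_coe _

theorem mk_add (x y : AlgTensor A B) : mk A B (x + y) = mk A B x + mk A B y :=
  Completion.coe_add x y

theorem mk_mul (x y : AlgTensor A B) : mk A B (x * y) = mk A B x * mk A B y :=
  Completion.coe_mul x y

theorem mk_smul (c : ℂ) (x : AlgTensor A B) : mk A B (c • x) = c • mk A B x :=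
  Completion.coe_smul c x

@[elab_as_elim]
theorem ind {p : MinTensor A B → Prop} (z : MinTensor A B) (hp : IsClosed {z | p z})
    (ih : ∀ x, p (mk A B x)) : p z :=
  Completion.induction_on (α := AlgTensor A B) z hp ih

instance : Star (MinTensor A B) where
  star := Completion.map (star : AlgTensor A B → AlgTensor A B)

theorem continuous_star' : Continuous (star : MinTensor A B → MinTensor A B) :=
  Completion.continuous_map

theorem star_mk (x : AlgTensor A B) : star (mk A B x) = mk A B (star x) :=
  Completion.map_coe (starₗᵢ ℂ : AlgTensor A B ≃ₗᵢ⋆[ℂ] AlgTensor A B).isometry.uniformContinuous x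

instance : StarRing (MinTensor A B) where
  star_involutive z := by
    refine ind z (isClosed_eq (continuous_star'.comp continuous_star') continuous_id) fun x => ?_
    rw [star_mk, star_mk, star_star]
  star_mul z z' := by
    refine ind z (isClosed_eq (continuous_star'.comp (by fun_prop))
      (continuous_const.mul continuous_star')) fun x => ?_
    refine ind z' (isClosed_eq (continuous_star'.comp (by fun_prop))
      (continuous_star'.mul continuous_const)) fun y => ?_
    rw [← mk_mul, star_mk, star_mk, star_mk, star_mul, mk_mul]
  star_add z z' := by
    refine ind z (isClosed_eq (continuous_star'.comp (by fun_prop))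
      (continuous_star'.add continuous_const)) fun x => ?_
    refine ind z' (isClosed_eq (continuous_star'.comp (by fun_prop))
      (continuous_const.add continuous_star')) fun y => ?_
    rw [← mk_add, star_mk, star_mk, star_mk, star_add, mk_add]

instance : CStarRing (MinTensor A B) where
  norm_mul_self_le z := by
    refine ind z (isClosed_le (continuous_norm.mul continuous_norm)
      ((continuous_star'.mul continuous_id).norm)) fun x => ?_
    rw [star_mk, ← mk_mul, norm_mk, norm_mk]
    exact AlgTensor.norm_mul_self_le x

instance : StarModule ℂ (MinTensor A B) where
  star_smul c z := by
    refine ind z (isClosed_eq (continuous_star'.comp (continuous_const_smul c))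
      ((continuous_const_smul (star c)).comp continuous_star')) fun x => ?_
    rw [← mk_smul, star_mk, star_mk, star_smul, mk_smul]

instance : CStarAlgebra (MinTensor A B) where

variable (A B) in
/-- The canonical star homomorphism from the algebraic to the minimal tensor product. -/
def of : AlgTensor A B →⋆ₐ[ℂ] MinTensor A B where
  toFun x := mk A B x
  map_one' := Completion.coe_one (AlgTensor A B)
  map_mul' x y := mk_mul x y
  map_zero' := Completion.coe_zero (α := AlgTensor A B)
  map_add' x y := mk_add x y
  commutes' c := by
    rw [Algebra.algebraMap_eq_smul_one, Algebra.algebraMap_eq_smul_one]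
    exact (mk_smul c 1).trans (congrArg (c • ·) (Completion.coe_one (AlgTensor A B)))
  map_star' x := (star_mk x).symm

/-- The elementary tensor `a ⊗ b` in the minimal tensor product. -/
def tmul (a : A) (b : B) : MinTensor A B := mk A B (a ⊗ₜ[ℂ] b : A ⊗[ℂ] B)

/-- Extension by continuity of a contractive star homomorphism on the algebraic tensor product. -/
def lift (φ : AlgTensor A B →ₐ[ℂ] C) (hstar : ∀ x, φ (star x) = star (φ x))
    (hφ : ∀ x, ‖φ x‖ ≤ ‖x‖) : MinTensor A B →⋆ₐ[ℂ] C :=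
  have hc : Continuous (φ : AlgTensor A B →+* C) :=
    AddMonoidHomClass.continuous_of_bound (φ : AlgTensor A B →+* C) 1
      fun x => by rw [one_mul]; exact hφ x
  let F : MinTensor A B →+* C :=
    Completion.extensionHom (α := AlgTensor A B) (φ : AlgTensor A B →+* C) hc
  have hF : ∀ x, F (mk A B x) = φ x :=
    Completion.extensionHom_coe (α := AlgTensor A B) (φ : AlgTensor A B →+* C) hc
  have hFc : Continuous F := Completion.continuous_extension
  { F with
    commutes' := fun c => by
      have : algebraMap ℂ (MinTensor A B) c = mk A B (algebraMap ℂ (AlgTensor A B) c) :=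
        ((of A B).toAlgHom.commutes c).symm
      change F _ = _
      rw [this, hF]
      exact φ.commutes c
    map_star' := fun z => by
      change F (star z) = star (F z)
      refine ind z (isClosed_eq (hFc.comp continuous_star') (hFc.star)) fun x => ?_
      rw [star_mk, hF, hF]
      exact hstar x }

/-- The representation `π ⊗ ρ` of the minimal tensor product, `a ⊗ b ↦ π a ⊗ ρ b`. -/
def rep (π : HilbertRep A) (ρ : HilbertRep B) : HilbertRep (MinTensor A B) where
  space := HilbertTensor π.space ρ.space
  hom := lift (AlgTensor.rep π ρ) (AlgTensor.rep_star π ρ) (AlgTensor.norm_rep_le π ρ)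

/-- The star homomorphism `f ⊗ g` between minimal tensor products, `a ⊗ b ↦ f a ⊗ g b`. -/
def map (f : A →⋆ₐ[ℂ] C) (g : B →⋆ₐ[ℂ] D) : MinTensor A B →⋆ₐ[ℂ] MinTensor C D :=
  lift ((of C D).toAlgHom.comp (AlgTensor.map f g))
    (fun x => by
      change mk C D (AlgTensor.map f g (star x)) = star (mk C D (AlgTensor.map f g x))
      rw [star_mk, AlgTensor.map_star_eq])
    (fun x => (norm_mk _).le.trans (AlgTensor.norm_map_le f g x))

/-- `x` and `y` correspond to each other under the canonical identification
`(A ⊗ B) ⊗ C = A ⊗ (B ⊗ C)` of minimal tensor products: for all representations `π₁`, `π₂`, `π₃` the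
operators `((π₁ ⊗ π₂) ⊗ π₃) x` on `(H₁ ⊗ H₂) ⊗ H₃` and `(π₁ ⊗ (π₂ ⊗ π₃)) y` on `H₁ ⊗ (H₂ ⊗ H₃)`
agree, the two Hilbert spaces being identified by the associator. (These representations are jointly
faithful on either side, by the definition of the minimal norm as the spatial one.) -/
def AssocEq (x : MinTensor (MinTensor A B) C) (y : MinTensor A (MinTensor B C)) : Prop :=
  ∀ (π₁ : HilbertRep A) (π₂ : HilbertRep B) (π₃ : HilbertRep C)
    (ζ : HilbertTensor (HilbertTensor π₁.space π₂.space) π₃.space),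
    HilbertTensor.assoc π₁.space π₂.space π₃.space ((rep (rep π₁ π₂) π₃).hom x ζ) =
      (rep π₁ (rep π₂ π₃)).hom y (HilbertTensor.assoc π₁.space π₂.space π₃.space ζ)

end MinTensor

end MinTensor

/-! ### Compact quantum groups and their finite-dimensional representations -/

/-- A compact quantum group `𝔾`: a unital C⋆-algebra `C(𝔾)` with a unital star homomorphism
`Δ : C(𝔾) → C(𝔾) ⊗ C(𝔾)` (minimal tensor product) that is coassociative and for which the sets
`{Δ(a)(b ⊗ 1)}` and `{Δ(a)(1 ⊗ b)}` span dense subspaces. -/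
structure CompactQuantumGroup where
  /-- The C⋆-algebra `C(𝔾)`. -/
  C : Type w
  [cstar : CStarAlgebra C]
  /-- The comultiplication. -/
  Δ : C →⋆ₐ[ℂ] MinTensor C C
  coassoc : ∀ a : C, MinTensor.AssocEq
    (MinTensor.map Δ (StarAlgHom.id ℂ C) (Δ a)) (MinTensor.map (StarAlgHom.id ℂ C) Δ (Δ a))
  dense_left : Dense
    (Submodule.span ℂ {x | ∃ a b : C, x = Δ a * MinTensor.tmul b 1} : Set (MinTensor C C))
  dense_right : Dense
    (Submodule.span ℂ {x | ∃ a b : C, x = Δ a * MinTensor.tmul 1 b} : Set (MinTensor C C))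

attribute [instance] CompactQuantumGroup.cstar

namespace CompactQuantumGroup

variable {G : CompactQuantumGroup.{w}}

variable (G) in
/-- A finite-dimensional representation of `𝔾`, on the Hilbert space `ℂ^ι` with its standard
orthonormal basis: an invertible matrix `u = (u_ij)` over `C(𝔾)` with
`Δ(u_ij) = ∑_k u_ik ⊗ u_kj`. -/
structure Rep (ι : Type) [Fintype ι] [DecidableEq ι] where
  mat : Matrix ι ι G.C
  isUnit_mat : IsUnit mat
  Δ_mat : ∀ i j, G.Δ (mat i j) = ∑ k, MinTensor.tmul (mat i k) (mat k j)

namespace Rep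

variable {ι κ : Type} [Fintype ι] [DecidableEq ι] [Fintype κ] [DecidableEq κ]

/-- The representation is unitary: `u u* = 1 = u* u`. -/
def IsUnitary (u : G.Rep ι) : Prop := u.mat ∈ unitary (Matrix ι ι G.C)

variable (G) in
/-- `T ⊗ 1 ∈ B(H, K) ⊗ C(𝔾)`, as a matrix over `C(𝔾)` in the standard orthonormal bases. -/
def ampl (T : EuclideanSpace ℂ ι →L[ℂ] EuclideanSpace ℂ κ) : Matrix κ ι G.C :=
  (LinearMap.toMatrix (EuclideanSpace.basisFun ι ℂ).toBasis (EuclideanSpace.basisFun κ ℂ).toBasis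
    T.toLinearMap).map (algebraMap ℂ G.C)

/-- The intertwiners `Hom(u, v) = {T ∈ B(H_u, H_v) : v (T ⊗ 1) = (T ⊗ 1) u}`. -/
def Hom (u : G.Rep ι) (v : G.Rep κ) : Set (EuclideanSpace ℂ ι →L[ℂ] EuclideanSpace ℂ κ) :=
  {T | v.mat * ampl G T = ampl G T * u.mat}

/-- `u` and `v` are equivalent: there is an invertible operator in `Hom(u, v)`. -/
def Equivalent (u : G.Rep ι) (v : G.Rep κ) : Prop :=
  ∃ T : EuclideanSpace ℂ ι ≃L[ℂ] EuclideanSpace ℂ κ,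
    (T : EuclideanSpace ℂ ι →L[ℂ] EuclideanSpace ℂ κ) ∈ Hom u v

/-- `u` is irreducible: `H_u ≠ 0` and `Hom(u, u) = ℂ · Id`. -/
def IsIrreducible (u : G.Rep ι) : Prop :=
  Nonempty ι ∧ Hom u u = {T | ∃ c : ℂ, T = c • ContinuousLinearMap.id ℂ (EuclideanSpace ℂ ι)}

/-- An operator `X ∈ B(H_u)` is `𝔾_u`-invariant: `u (X ⊗ 1) u* = X ⊗ 1`. -/
def IsInvariant (u : G.Rep ι) (X : EuclideanSpace ℂ ι →L[ℂ] EuclideanSpace ℂ ι) : Prop :=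
  u.mat * ampl G X * star u.mat = ampl G X

/-- A state on a finite-dimensional Hilbert space: a positive operator of trace one. -/
def _root_.IsState (ρ : EuclideanSpace ℂ ι →L[ℂ] EuclideanSpace ℂ ι) : Prop :=
  ρ.IsPositive ∧ LinearMap.trace ℂ (EuclideanSpace ℂ ι) ρ.toLinearMap = 1

/-- The set of `𝔾_u`-invariant states. -/
def invariantStates (u : G.Rep ι) : Set (EuclideanSpace ℂ ι →L[ℂ] EuclideanSpace ℂ ι) :=
  {ρ | IsState ρ ∧ u.IsInvariant ρ}

section directSum

variable {n : ℕ} {d : Fin n → ℕ}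

/-- The direct sum `⊕ₖ uₖ`, block diagonal on `⊕ₖ H_{uₖ}`; the Hilbert space sum of the
`H_{uₖ} = ℂ^(d k)` is `ℂ^ι` for the disjoint union `ι` of the index sets. -/
def directSum (u : ∀ k, G.Rep (Fin (d k))) : G.Rep (Σ k, Fin (d k)) where
  mat := Matrix.blockDiagonal' fun k => (u k).mat
  isUnit_mat := by
    have h : IsUnit (fun k => (u k).mat) := Pi.isUnit_iff.2 fun k => (u k).isUnit_mat
    exact h.map (Matrix.blockDiagonal'RingHom (fun k => Fin (d k)) G.C)
  Δ_mat := by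
    have z1 : ∀ b : G.C, MinTensor.tmul (0 : G.C) b = 0 := fun b => by
      unfold MinTensor.tmul
      rw [TensorProduct.zero_tmul]
      exact map_zero (MinTensor.of G.C G.C)
    have z2 : ∀ a : G.C, MinTensor.tmul a (0 : G.C) = 0 := fun a => by
      unfold MinTensor.tmul
      rw [TensorProduct.tmul_zero]
      exact map_zero (MinTensor.of G.C G.C)
    rintro ⟨k, i⟩ ⟨l, j⟩
    rw [Fintype.sum_sigma, Finset.sum_eq_single k]
    · by_cases h : k = l
      · subst h
        simp only [Matrix.blockDiagonal'_apply_eq]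
        exact (u k).Δ_mat i j
      · simp only [Matrix.blockDiagonal'_apply_ne _ _ _ h, map_zero, z2, Finset.sum_const_zero]
    · intro m _ hm
      simp only [Matrix.blockDiagonal'_apply_ne _ _ _ hm.symm, z1, Finset.sum_const_zero]
    · simp

variable (d) in
/-- The summand `H_{uₖ}` of `⊕ₖ H_{uₖ}`. -/
def summand (k : Fin n) : Submodule ℂ (EuclideanSpace ℂ (Σ k, Fin (d k))) where
  carrier := {x | ∀ i : Σ k, Fin (d k), i.1 ≠ k → x i = 0}
  add_mem' hx hy i hi := by simp [hx i hi, hy i hi]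
  zero_mem' i _ := rfl
  smul_mem' c x hx i hi := by simp [hx i hi]

variable (d) in
/-- The orthogonal projection `pₖ` of `⊕ₖ H_{uₖ}` onto the summand `H_{uₖ}`. -/
def proj (k : Fin n) :
    EuclideanSpace ℂ (Σ k, Fin (d k)) →L[ℂ] EuclideanSpace ℂ (Σ k, Fin (d k)) :=
  (summand d k).starProjection

end directSum

end Rep

end CompactQuantumGroup

end

/-! ### Extreme points of simplices and of linear images -/

/-! Since u is unitary, X is invariant exactly when it intertwines u with itself. Cut X into blocks:
the (j, k) block then intertwines u_k with u_j. By Schur's lemma the blocks with j ≠ k vanish and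
the diagonal blocks are scalar, so X = ∑ c_k p_k (`directSum_isInvariant_iff`).

Schur's lemma for inequivalent irreducibles (`intertwiner_eq_zero`) rests on unitarity: if M
intertwines u and v, then M* intertwines v and u. Hence M*M and MM* are scalars, and a nonzero M
would be invertible up to a scalar.

As p_k has trace d_k, the operator ∑ c_k p_k is a state iff all c_k ≥ 0 and ∑ c_k d_k = 1. In the
weights x_k = c_k d_k this is the standard simplex, so the invariant states are its image under the
injective linear map e_k ↦ p_k / d_k (`invariantStates_directSum`). Convexity is inherited, and the
extreme points are the images of the vertices. -/

/-- A linear map carries open segments onto open segments. Injectivity pulls a point of the image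
segment back to the original one, and pulls equality of endpoints back as well. -/
theorem Function.Injective.extremePoints_image {E F : Type*} [AddCommGroup E] [Module ℝ E]
    [AddCommGroup F] [Module ℝ F] {f : E →ₗ[ℝ] F} (hf : Function.Injective f) (s : Set E) :
    Set.extremePoints ℝ (f '' s) = f '' Set.extremePoints ℝ s := by
  ext y
  constructor
  · rintro ⟨⟨x, hx, rfl⟩, h⟩
    refine ⟨x, ⟨hx, fun a ha b hb hab => hf ?_⟩, rfl⟩
    refine h ⟨a, ha, rfl⟩ ⟨b, hb, rfl⟩ ?_
    have := image_openSegment ℝ f.toAffineMap a b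
    simp only [LinearMap.coe_toAffineMap] at this
    rw [← this]
    exact ⟨x, hab, rfl⟩
  · rintro ⟨x, ⟨hx, h⟩, rfl⟩
    refine ⟨⟨x, hx, rfl⟩, ?_⟩
    rintro _ ⟨a, ha, rfl⟩ _ ⟨b, hb, rfl⟩ hab
    refine congrArg f (h ha hb ?_)
    have := image_openSegment ℝ f.toAffineMap a b
    simp only [LinearMap.coe_toAffineMap] at this
    rw [← this] at hab
    obtain ⟨z, hz, hzx⟩ := hab
    rwa [← hf hzx]

/-- The simplex is the convex hull of its vertices, so nothing else can be extreme. Conversely, a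
vertex has all but one coordinate at the lower bound 0, which pins down any segment through it. -/
theorem extremePoints_stdSimplex {ι : Type*} [Fintype ι] [DecidableEq ι] :
    Set.extremePoints ℝ (stdSimplex ℝ ι) = Set.range fun i => (Pi.single i 1 : ι → ℝ) := by
  apply Set.Subset.antisymm
  · rw [← convexHull_rangle_single_eq_stdSimplex]
    exact extremePoints_convexHull_subset
  · rintro _ ⟨i, rfl⟩
    refine ⟨single_mem_stdSimplex ℝ i, ?_⟩
    rintro a ha b hb ⟨s, t, hs, ht, hst, h⟩
    -- Here s * a j + t * b j = 0 with both terms nonnegative and s > 0. The remaining coordinate of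
    -- a is then 1 because the coordinates sum to 1.
    have h0 : ∀ j, j ≠ i → a j = 0 := fun j hj => by
      have := congrFun h j
      simp only [Pi.add_apply, Pi.smul_apply, smul_eq_mul, Pi.single_eq_of_ne hj] at this
      have h1 := mul_nonneg hs.le (ha.1 j)
      have h2 := mul_nonneg ht.le (hb.1 j)
      have h3 : s * a j = 0 := by linarith
      exact (mul_eq_zero.1 h3).resolve_left hs.ne'
    have h1 : a i = 1 := by
      rw [← ha.2]
      exact (Finset.sum_eq_single i (fun j _ hj => h0 j hj) (by simp)).symm
    ext j
    by_cases hj : j = i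
    · subst hj; simp [h1]
    · simp [h0 j hj, hj]

namespace CompactQuantumGroup

variable {G : CompactQuantumGroup.{w}}

namespace Rep

open scoped ComplexOrder

set_option linter.unusedSectionVars false

variable {ι κ : Type} [Fintype ι] [DecidableEq ι] [Fintype κ] [DecidableEq κ]

/-! ### Operators and their matrices -/

/-- The matrix of an operator in the standard orthonormal bases. -/
noncomputable def toMat :
    (EuclideanSpace ℂ ι →L[ℂ] EuclideanSpace ℂ κ) ≃ₗ[ℂ] Matrix κ ι ℂ :=
  LinearMap.toContinuousLinearMap.symm.trans
    (LinearMap.toMatrix (EuclideanSpace.basisFun ι ℂ).toBasis (EuclideanSpace.basisFun κ ℂ).toBasis)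

theorem toMat_comp {μ : Type} [Fintype μ] (S : EuclideanSpace ℂ κ →L[ℂ] EuclideanSpace ℂ μ)
    (T : EuclideanSpace ℂ ι →L[ℂ] EuclideanSpace ℂ κ) :
    toMat (S.comp T) = toMat S * toMat T :=
  LinearMap.toMatrix_comp _ _ _ S.toLinearMap T.toLinearMap

theorem toMat_id : toMat (ContinuousLinearMap.id ℂ (EuclideanSpace ℂ ι)) = 1 :=
  LinearMap.toMatrix_id _

theorem toMat_apply (T : EuclideanSpace ℂ ι →L[ℂ] EuclideanSpace ℂ κ) (i : κ) (j : ι) :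
    toMat T i j = T (EuclideanSpace.single j 1) i := by
  simp [toMat, LinearMap.toMatrix_apply]

theorem ampl_eq (T : EuclideanSpace ℂ ι →L[ℂ] EuclideanSpace ℂ κ) :
    ampl G T = (toMat T).map (algebraMap ℂ G.C) := rfl

theorem trace_eq (T : EuclideanSpace ℂ ι →L[ℂ] EuclideanSpace ℂ ι) :
    LinearMap.trace ℂ (EuclideanSpace ℂ ι) T.toLinearMap = (toMat T).trace :=
  LinearMap.trace_eq_matrix_trace ℂ _ _

/-- Right multiplication by u, respectively by u*, passes between the two relations. This puts
invariance within reach of Schur's lemma. -/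
theorem isInvariant_iff_commute {u : G.Rep ι} (hu : u.IsUnitary)
    (X : EuclideanSpace ℂ ι →L[ℂ] EuclideanSpace ℂ ι) :
    u.IsInvariant X ↔ u.mat * ampl G X = ampl G X * u.mat := by
  constructor
  · intro h
    have h' : u.mat * ampl G X * star u.mat = ampl G X := h
    have h2 := congrArg (· * u.mat) h'
    simpa only [mul_assoc, Unitary.star_mul_self_of_mem hu, mul_one] using h2
  · intro h
    change u.mat * ampl G X * star u.mat = ampl G X
    rw [h, mul_assoc, Unitary.mul_star_self_of_mem hu, mul_one]

/-! ### Schur's lemma -/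

/-- Irreducibility in matrix form, so that it applies directly to blocks of the matrix of an
operator. -/
theorem IsIrreducible.eq_smul_one {u : G.Rep ι} (hu : u.IsIrreducible) {M : Matrix ι ι ℂ}
    (hM : u.mat * M.map (algebraMap ℂ G.C) = M.map (algebraMap ℂ G.C) * u.mat) :
    ∃ c : ℂ, M = c • 1 := by
  have h : toMat.symm M ∈ Hom u u := by
    simpa only [Hom, Set.mem_ofPred_eq, ampl_eq, LinearEquiv.apply_symm_apply] using hM
  rw [hu.2] at h
  obtain ⟨c, hc⟩ := h
  refine ⟨c, ?_⟩
  rw [← toMat_id, ← map_smul, ← hc, LinearEquiv.apply_symm_apply]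

theorem equivalent_of_matrix {u : G.Rep ι} {v : G.Rep κ} {M : Matrix κ ι ℂ} {N : Matrix ι κ ℂ}
    (hM : v.mat * M.map (algebraMap ℂ G.C) = M.map (algebraMap ℂ G.C) * u.mat)
    (h1 : M * N = 1) (h2 : N * M = 1) : u.Equivalent v := by
  refine ⟨ContinuousLinearEquiv.equivOfInverse (toMat.symm M) (toMat.symm N) ?_ ?_, ?_⟩
  · intro x
    have : (toMat.symm N).comp (toMat.symm M) = ContinuousLinearMap.id ℂ _ :=
      toMat.injective (by simp [toMat_comp, h2, toMat_id])
    exact DFunLike.congr_fun this x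
  · intro x
    have : (toMat.symm M).comp (toMat.symm N) = ContinuousLinearMap.id ℂ _ :=
      toMat.injective (by simp [toMat_comp, h1, toMat_id])
    exact DFunLike.congr_fun this x
  · have : toMat.symm M ∈ Hom u v := by
      simpa only [Hom, Set.mem_ofPred_eq, ampl_eq, LinearEquiv.apply_symm_apply] using hM
    exact this

/-- The adjoint of v M = M u is M* v* = u* M*; multiply by u on the left and by v on the right. -/
theorem intertwiner_conjTranspose {u : G.Rep ι} {v : G.Rep κ} (hu : u.IsUnitary)
    (hv : v.IsUnitary) {M : Matrix κ ι ℂ}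
    (hM : v.mat * M.map (algebraMap ℂ G.C) = M.map (algebraMap ℂ G.C) * u.mat) :
    u.mat * M.conjTranspose.map (algebraMap ℂ G.C) =
      M.conjTranspose.map (algebraMap ℂ G.C) * v.mat := by
  have hstar : M.conjTranspose.map (algebraMap ℂ G.C) =
      (M.map (algebraMap ℂ G.C)).conjTranspose := by
    ext i j
    exact algebraMap_star_comm (M j i)
  have hu' : u.mat * u.mat.conjTranspose = 1 := Unitary.mul_star_self_of_mem hu
  have hv' : v.mat.conjTranspose * v.mat = 1 := Unitary.star_mul_self_of_mem hv
  have h := congrArg Matrix.conjTranspose hM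
  rw [Matrix.conjTranspose_mul, Matrix.conjTranspose_mul] at h
  rw [hstar]
  calc u.mat * (M.map (algebraMap ℂ G.C)).conjTranspose
      = u.mat * ((M.map (algebraMap ℂ G.C)).conjTranspose * v.mat.conjTranspose) * v.mat := by
        simp only [Matrix.mul_assoc, hv', Matrix.mul_one]
    _ = (M.map (algebraMap ℂ G.C)).conjTranspose * v.mat := by
        rw [h, ← Matrix.mul_assoc, hu', Matrix.one_mul]

/-- Schur's lemma: there is no nonzero intertwiner between inequivalent irreducible unitary
representations. -/
theorem intertwiner_eq_zero {u : G.Rep ι} {v : G.Rep κ} (hu : u.IsUnitary) (hv : v.IsUnitary)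
    (hui : u.IsIrreducible) (hvi : v.IsIrreducible) (h : ¬ u.Equivalent v) {M : Matrix κ ι ℂ}
    (hM : v.mat * M.map (algebraMap ℂ G.C) = M.map (algebraMap ℂ G.C) * u.mat) : M = 0 := by
  have hM' := intertwiner_conjTranspose hu hv hM
  -- M*M intertwines u with itself, passing through v; likewise MM* for v below.
  obtain ⟨a, ha⟩ := hui.eq_smul_one (M := M.conjTranspose * M) (by
    rw [Matrix.map_mul, ← Matrix.mul_assoc, hM', Matrix.mul_assoc, hM, Matrix.mul_assoc])
  obtain ⟨b, hb⟩ := hvi.eq_smul_one (M := M * M.conjTranspose) (by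
    rw [Matrix.map_mul, ← Matrix.mul_assoc, hM, Matrix.mul_assoc, hM', Matrix.mul_assoc])
  by_contra hne
  -- Both scalars are read off from M M* M, which equals a M and b M.
  have hab : a = b := by
    have h1 : M * (M.conjTranspose * M) = M * M.conjTranspose * M := (Matrix.mul_assoc ..).symm
    rw [ha, hb, Matrix.mul_smul, Matrix.smul_mul, Matrix.mul_one, Matrix.one_mul] at h1
    exact smul_left_injective ℂ hne h1
  -- If a = 0 then M*M = 0, which forces M = 0.
  have ha0 : a ≠ 0 := by
    rintro rfl
    rw [zero_smul, Matrix.conjTranspose_mul_self_eq_zero] at ha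
    exact hne ha
  subst hab
  -- Now a⁻¹ M* is a two-sided inverse of M, so M would be an equivalence.
  refine h (equivalent_of_matrix (N := a⁻¹ • M.conjTranspose) hM ?_ ?_)
  · rw [Matrix.mul_smul, hb, smul_smul, inv_mul_cancel₀ ha0, one_smul]
  · rw [Matrix.smul_mul, ha, smul_smul, inv_mul_cancel₀ ha0, one_smul]

/-! ### Invariant operators of a direct sum -/

section directSum

variable {n : ℕ} {d : Fin n → ℕ}

theorem directSum_isUnitary {u : ∀ k, G.Rep (Fin (d k))} (hu : ∀ k, (u k).IsUnitary) :
    (directSum u).IsUnitary := by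
  have h1 : ∀ k, (u k).mat.conjTranspose * (u k).mat = 1 :=
    fun k => Unitary.star_mul_self_of_mem (hu k)
  have h2 : ∀ k, (u k).mat * (u k).mat.conjTranspose = 1 :=
    fun k => Unitary.mul_star_self_of_mem (hu k)
  refine Unitary.mem_iff.2 ⟨?_, ?_⟩
  · change (Matrix.blockDiagonal' fun k => (u k).mat).conjTranspose *
      (Matrix.blockDiagonal' fun k => (u k).mat) = 1
    rw [Matrix.blockDiagonal'_conjTranspose, ← Matrix.blockDiagonal'_mul]
    simp only [h1]
    exact Matrix.blockDiagonal'_one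
  · change (Matrix.blockDiagonal' fun k => (u k).mat) *
      (Matrix.blockDiagonal' fun k => (u k).mat).conjTranspose = 1
    rw [Matrix.blockDiagonal'_conjTranspose, ← Matrix.blockDiagonal'_mul]
    simp only [h2]
    exact Matrix.blockDiagonal'_one

/-- The truncation of x to block k lies in the summand, and the rest of x is orthogonal to it; this
characterises the orthogonal projection. -/
theorem proj_apply (k : Fin n) (x : EuclideanSpace ℂ (Σ k, Fin (d k))) (i : Σ k, Fin (d k)) :
    proj d k x i = if i.1 = k then x i else 0 := by
  have h : proj d k x = WithLp.toLp 2 fun i => if i.1 = k then x i else 0 := by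
    refine Submodule.eq_starProjection_of_mem_of_inner_eq_zero (fun i hi => if_neg hi) ?_
    intro y hy
    rw [PiLp.inner_apply]
    refine Finset.sum_eq_zero fun i _ => ?_
    by_cases hi : i.1 = k
    · simp [hi]
    · simp [hy i hi]
  rw [h]

theorem toMat_sum_smul_proj (c : Fin n → ℂ) :
    toMat (∑ k, c k • proj d k) = Matrix.diagonal fun i : Σ k, Fin (d k) => c i.1 := by
  ext i j
  rw [toMat_apply]
  simp only [sum_apply, smul_apply, WithLp.ofLp_sum,
    Finset.sum_apply, PiLp.smul_apply, proj_apply, smul_eq_mul, mul_ite, mul_zero,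
    Finset.sum_ite_eq, Finset.mem_univ, if_true, Matrix.diagonal_apply]
  by_cases h : i = j <;> simp [h]

/-- This is the form in which Schur's lemma delivers the answer: diagonal, with entries depending
only on the block. -/
theorem mem_span_range_proj {X} :
    X ∈ Submodule.span ℂ (Set.range (proj d)) ↔
      ∃ c : Fin n → ℂ, toMat X = Matrix.diagonal fun i : Σ k, Fin (d k) => c i.1 := by
  rw [Submodule.mem_span_range_iff_exists_fun]
  refine exists_congr fun c => ?_
  rw [← toMat_sum_smul_proj, toMat.injective.eq_iff, eq_comm]

theorem directSum_isInvariant_iff {u : ∀ k, G.Rep (Fin (d k))}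
    (hunit : ∀ k, (u k).IsUnitary) (hirr : ∀ k, (u k).IsIrreducible)
    (hineq : ∀ j k, j ≠ k → ¬ (u j).Equivalent (u k)) (X) :
    (directSum u).IsInvariant X ↔ X ∈ Submodule.span ℂ (Set.range (proj d)) := by
  rw [isInvariant_iff_commute (directSum_isUnitary hunit), mem_span_range_proj, ampl_eq]
  constructor
  · intro h
    -- The block of X that maps H_{u_k} to H_{u_j}.
    let B (j k : Fin n) : Matrix (Fin (d j)) (Fin (d k)) ℂ :=
      (toMat X).submatrix (fun a => ⟨j, a⟩) (fun b => ⟨k, b⟩)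
    have hB : ∀ j k, (u j).mat * (B j k).map (algebraMap ℂ G.C) =
        (B j k).map (algebraMap ℂ G.C) * (u k).mat := by
      intro j k
      ext a b
      have hab := congrFun (congrFun h ⟨j, a⟩) ⟨k, b⟩
      simp only [Matrix.mul_apply, directSum] at hab ⊢
      -- Block diagonality of the direct sum leaves only summand j on the left-hand side and only
      -- summand k on the right.
      rw [Fintype.sum_sigma, Fintype.sum_sigma, Finset.sum_eq_single j, Finset.sum_eq_single k]
        at hab
      · simp only [Matrix.blockDiagonal'_apply_eq] at hab
        exact hab
      · intro m _ hm
        simp [Matrix.blockDiagonal'_apply_ne _ _ _ hm]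
      · simp
      · intro m _ hm
        simp [Matrix.blockDiagonal'_apply_ne _ _ _ hm.symm]
      · simp
    choose c hc using fun k => (hirr k).eq_smul_one (hB k k)
    refine ⟨c, ?_⟩
    ext ⟨j, a⟩ ⟨k, b⟩
    by_cases hjk : j = k
    · subst hjk
      have := congrFun (congrFun (hc j) a) b
      simpa [B, Matrix.diagonal_apply, Matrix.one_apply] using this
    -- The block `B j k` goes from u_k to u_j, hence the reversed order of the indices.
    · have h0 := intertwiner_eq_zero (hunit k) (hunit j) (hirr k) (hirr j)
        (hineq k j (Ne.symm hjk)) (hB j k)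
      have := congrFun (congrFun h0 a) b
      simpa [B, Matrix.diagonal_apply, hjk] using this
  · rintro ⟨c, hc⟩
    rw [hc]
    ext ⟨j, a⟩ ⟨k, b⟩
    simp only [Matrix.diagonal_map (map_zero _), Matrix.mul_diagonal, Matrix.diagonal_mul,
      directSum]
    -- Within a block the diagonal entry is constant and scalars are central; off the blocks both
    -- sides vanish.
    by_cases hjk : j = k
    · subst hjk
      exact (Algebra.commutes _ _).symm
    · simp [Matrix.blockDiagonal'_apply_ne _ _ _ hjk]

/-! ### Invariant states -/

theorem proj_isPositive (k : Fin n) : (proj d k).IsPositive :=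
  ContinuousLinearMap.IsPositive.of_isStarProjection isStarProjection_starProjection

variable (d) in
/-- The mixture of the states `pₖ / dₖ` with given weights. -/
noncomputable def mixture : (Fin n → ℝ) →ₗ[ℝ]
    (EuclideanSpace ℂ (Σ k, Fin (d k)) →L[ℂ] EuclideanSpace ℂ (Σ k, Fin (d k))) :=
  Fintype.linearCombination ℝ fun k => (1 / (d k : ℂ)) • proj d k

/-- The weights are real because convexity is taken over ℝ; as complex coefficients they fit the
span of the projections and `toMat_sum_smul_proj`. -/
theorem mixture_apply (x : Fin n → ℝ) :
    mixture d x = ∑ k, ((x k : ℂ) / d k) • proj d k := by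
  simp only [mixture, Fintype.linearCombination_apply]
  refine Finset.sum_congr rfl fun k _ => ?_
  rw [← Complex.coe_smul, smul_smul, mul_one_div]

theorem mixture_single (k : Fin n) :
    mixture d (Pi.single k 1) = (1 / (d k : ℂ)) • proj d k := by
  simp [mixture, Fintype.linearCombination_apply_single]

theorem mixture_injective (hd : ∀ k, 0 < d k) : Function.Injective (mixture d) := by
  intro x y hxy
  have h := congrArg toMat hxy
  rw [mixture_apply, mixture_apply, toMat_sum_smul_proj, toMat_sum_smul_proj,
    Matrix.diagonal_injective.eq_iff] at h
  ext k
  -- A nonempty block has a first basis vector, whose diagonal entry reveals the coefficient.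
  have hk := congrFun h ⟨k, ⟨0, hd k⟩⟩
  have : (d k : ℂ) ≠ 0 := Nat.cast_ne_zero.2 (hd k).ne'
  simpa [div_left_inj' this] using hk

/-- The trace of p_k is the block size d k. Each c k is a diagonal entry of the operator, so
positivity forces c k ≥ 0; conversely a nonnegative combination of projections is positive. -/
theorem isState_sum_smul_proj_iff {c : Fin n → ℂ} (hd : ∀ k, 0 < d k) :
    IsState (∑ k, c k • proj d k) ↔ (∀ k, 0 ≤ c k) ∧ ∑ k, c k * d k = 1 := by
  have htr : LinearMap.trace ℂ (EuclideanSpace ℂ (Σ k, Fin (d k)))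
      (∑ k, c k • proj d k : _ →L[ℂ] _).toLinearMap = ∑ k, c k * d k := by
    rw [trace_eq, toMat_sum_smul_proj, Matrix.trace_diagonal, Fintype.sum_sigma]
    simp [mul_comm]
  unfold IsState
  rw [htr]
  refine and_congr_left fun _ => ⟨fun h k => ?_, fun h => ?_⟩
  · have h1 := h.inner_nonneg_right (EuclideanSpace.single ⟨k, ⟨0, hd k⟩⟩ 1)
    have h2 := toMat_apply (∑ k, c k • proj d k) ⟨k, ⟨0, hd k⟩⟩ ⟨k, ⟨0, hd k⟩⟩
    rw [toMat_sum_smul_proj, Matrix.diagonal_apply_eq] at h2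
    rw [EuclideanSpace.inner_single_left, ← h2] at h1
    simpa using h1
  · exact ContinuousLinearMap.isPositive_sum _ fun k _ => (proj_isPositive k).smul_of_nonneg (h k)

theorem invariantStates_directSum {u : ∀ k, G.Rep (Fin (d k))}
    (hunit : ∀ k, (u k).IsUnitary) (hirr : ∀ k, (u k).IsIrreducible)
    (hineq : ∀ j k, j ≠ k → ¬ (u j).Equivalent (u k)) :
    (directSum u).invariantStates = mixture d '' stdSimplex ℝ (Fin n) := by
  have hd : ∀ k, 0 < d k := fun k => Fin.pos_iff_nonempty.2 (hirr k).1
  have hd' : ∀ k, (d k : ℂ) ≠ 0 := fun k => Nat.cast_ne_zero.2 (hd k).ne'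
  ext X
  simp only [invariantStates, Set.mem_ofPred_eq, directSum_isInvariant_iff hunit hirr hineq,
    Submodule.mem_span_range_iff_exists_fun]
  constructor
  · rintro ⟨hX, c, rfl⟩
    obtain ⟨h0, h1⟩ := (isState_sum_smul_proj_iff hd).1 hX
    -- In the order on ℂ, 0 ≤ c k includes that c k is real.
    have hre : ∀ k, ((c k).re : ℂ) = c k := fun k => (Complex.eq_re_of_ofReal_le (h0 k)).symm
    -- The weight of p_k / d_k is the trace of c_k p_k.
    refine ⟨fun k => (c k).re * d k, ⟨fun k => ?_, ?_⟩, ?_⟩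
    · exact mul_nonneg (Complex.nonneg_iff.1 (h0 k)).1 (Nat.cast_nonneg _)
    · apply Complex.ofReal_injective
      push_cast
      simpa only [hre] using h1
    · rw [mixture_apply]
      refine Finset.sum_congr rfl fun k _ => ?_
      push_cast
      rw [hre, mul_div_cancel_right₀ _ (hd' k)]
  · rintro ⟨x, hx, rfl⟩
    rw [mixture_apply]
    refine ⟨(isState_sum_smul_proj_iff hd).2 ⟨fun k => ?_, ?_⟩, _, rfl⟩
    · have := div_nonneg (hx.1 k) (Nat.cast_nonneg (α := ℝ) (d k))
      exact_mod_cast this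
    · simp only [div_mul_cancel₀ _ (hd' _)]
      exact_mod_cast hx.2

end directSum

end Rep

end CompactQuantumGroup

theorem mainTheorem4 (G : CompactQuantumGroup.{w}) {n : ℕ} {d : Fin n → ℕ}
    (u : ∀ k, G.Rep (Fin (d k)))
    (hunit : ∀ k, (u k).IsUnitary)
    (hirr : ∀ k, (u k).IsIrreducible)
    (hineq : ∀ j k, j ≠ k → ¬ (u j).Equivalent (u k)) :
    (∀ X, (CompactQuantumGroup.Rep.directSum u).IsInvariant X ↔
      X ∈ Submodule.span ℂ (Set.range (CompactQuantumGroup.Rep.proj d))) ∧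
    Convex ℝ (CompactQuantumGroup.Rep.directSum u).invariantStates ∧
    Set.extremePoints ℝ (CompactQuantumGroup.Rep.directSum u).invariantStates =
      {ρ | ∃ k, ρ = (1 / (d k : ℂ)) • CompactQuantumGroup.Rep.proj d k} := by
  -- Irreducible representations act on nonzero spaces; this makes `mixture` injective, so extreme
  -- points transfer from the simplex.
  have hd : ∀ k, 0 < d k := fun k => Fin.pos_iff_nonempty.2 (hirr k).1
  refine ⟨CompactQuantumGroup.Rep.directSum_isInvariant_iff hunit hirr hineq, ?_⟩
  rw [CompactQuantumGroup.Rep.invariantStates_directSum hunit hirr hineq]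
  refine ⟨(convex_stdSimplex ℝ (Fin n)).linear_image _, ?_⟩
  rw [(CompactQuantumGroup.Rep.mixture_injective hd).extremePoints_image,
    extremePoints_stdSimplex, ← Set.range_comp]
  ext ρ
  simp only [Set.mem_range, Function.comp_apply, CompactQuantumGroup.Rep.mixture_single,
    Set.mem_ofPred_eq, eq_comm]
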